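/- Let $N \ge 2$ and $n \ge 3$ be integers, let $R = \mathbb{C}[x_0,\dots,x_N]$ and let $$F_{N,n} = \prod_{0 \le i < j \le N} (x_i^n - x_j^n) \in R.$$ The Fermat arrangement consists of the hyperplanes in $\mathbb{P}^N = \mathbb{P}^N_{\mathbb{C}}$ defined by the linear factors of $F_{N,n}$. Let $V_{N,n} \subset \mathbb{P}^N$ be the union of all linear flats of codimension $2$ that are contained in at least $3$ hyperplanes of this arrangement, and let $I = I_{N,n} \subset R$ be the radical homogeneous ideal of all polynomials vanishing along $V_{N,n}$. For $m \ge 0$ let $$I^{(m)} = \bigcap_{P \in \mathrm{Ass}(R/I)} \left( I^m R_P \cap R \right)$$ be the $m$-th symbolic power of $I$. Then $$I^{(3)} \not\subseteq I^2.$$ Moreover, the polynomial $F_{N,n}$ is a witness: $F_{N,n} \in P^3$ for every $P \in \mathrm{Ass}(R/I)$, $F_{N,n} \in I^{(3)}$, and $F_{N,n} \notin I^2$. -/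

import Mathlib

namespace FermatFlats

open MvPolynomial
open scoped LinearAlgebra.Projectivization

noncomputable section

/-- The homogeneous coordinate ring `ℂ[x_0, …, x_N]` of `ℙ^N`. -/
abbrev CoordRing (N : ℕ) : Type := MvPolynomial (Fin (N + 1)) ℂ

/-- The Fermat polynomial `F_{N,n} = ∏_{0 ≤ i < j ≤ N} (x_i^n - x_j^n)`. -/
def fermatPoly (N n : ℕ) : CoordRing N :=
  ∏ i : Fin (N + 1), ∏ j ∈ Finset.Ioi i, (X i ^ n - X j ^ n)

/-- The Fermat arrangement: the hyperplanes of `ℙ^N`, given as linear hyperplanes of `ℂ^{N+1}`,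
that are the zero loci of the linear factors of `F_{N,n}`. -/
def fermatArrangement (N n : ℕ) : Set (Submodule ℂ (Fin (N + 1) → ℂ)) :=
  {H | ∃ l : CoordRing N, l ≠ 0 ∧ l.IsHomogeneous 1 ∧ l ∣ fermatPoly N n ∧
    ∀ v, v ∈ H ↔ eval v l = 0}

/-- The codimension `2` flats of `ℙ^N`, given as linear subspaces of codimension `2` in `ℂ^{N+1}`,
that are contained in at least `3` hyperplanes of the Fermat arrangement. -/
def fermatFlats (N n : ℕ) : Set (Submodule ℂ (Fin (N + 1) → ℂ)) :=
  {W | Module.finrank ℂ W + 2 = N + 1 ∧ 3 ≤ {H ∈ fermatArrangement N n | W ≤ H}.encard}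

/-- The union `V_{N,n} ⊆ ℙ^N` of these flats. -/
def fermatLocus (N n : ℕ) : Set (ℙ ℂ (Fin (N + 1) → ℂ)) :=
  {p | ∃ W ∈ fermatFlats N n, p.submodule ≤ W}

/-- The ideal of a subset of `ℙ^N`: all polynomials that vanish at all homogeneous
coordinate vectors of all its points. -/
def idealOf {N : ℕ} (V : Set (ℙ ℂ (Fin (N + 1) → ℂ))) : Ideal (CoordRing N) :=
  vanishingIdeal ℂ {v | ∃ hv : v ≠ 0, Projectivization.mk ℂ v hv ∈ V}

/-- The radical ideal `I_{N,n}` of `V_{N,n}`. -/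
def fermatIdeal (N n : ℕ) : Ideal (CoordRing N) := idealOf (fermatLocus N n)

/-- The `m`-th symbolic power `I^{(m)} = ⋂_{P ∈ Ass(I)} (I^m R_P ∩ R)`, where `Ass(I)` is the set
of associated primes of the `R`-module `R/I`. -/
def symbolicPower {R : Type*} [CommRing R] (I : Ideal R) (m : ℕ) : Ideal R :=
  ⨅ P : associatedPrimes R (R ⧸ I),
    ((I ^ m).map (algebraMap R (Localization.AtPrime P.1))).comap
      (algebraMap R (Localization.AtPrime P.1))

end

end FermatFlats

namespace FermatFlats

open MvPolynomial
open scoped LinearAlgebra.Projectivization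

/-! ### The Fermat arrangement and its flats -/

/-! Membership in `I^(3)`: `I` contains the intersection of the ideals of the finitely many flats,
so a prime `P ⊇ I` contains the ideal of some flat `W`. At least three hyperplanes of the
arrangement contain `W`; their equations are pairwise non-associate primes dividing `F`, so their
product divides `F`, and each lies in `P`. Hence `F ∈ P^3`. As `I` is radical, `mem_symbolicPower`
turns this into `F ∈ I^(3)`.

Non-membership in `I^2`: a linear functional vanishes on `I^2` but not at `F`. Specialise `x_3, x_4,
…` to the constants `1, 2, …` and write `x, y, z` for the remaining variables. Elements of `I` then
vanish on the punctured lines over the Fermat points of the plane. Averaging over roots of unity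
gives linear relations between their coefficients: those of `x^a y^b` and `x^a z^b` are zero for `a,
b < n`, pure powers do not occur, and the coefficients of `x^a y^n` and `x^a z^n` are opposite for
`a < n`. In a product of two such polynomials, the coefficient of `x^n y^{2n}` therefore only
involves products of coefficients of `x^a y^n` and `x^{n-a} y^n`. Replacing `y` by `z` changes both
signs, so the coefficients of `x^n y^{2n}` and `x^n z^{2n}` agree (`coeff_mul_eq`). For the
specialised `F` they are `-c` and `c` with `c ≠ 0`. -/

theorem X_pow_sub_X_pow_dvd_fermatPoly {N n : ℕ} {i j : Fin (N + 1)} (hij : i ≠ j) :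
    (X i ^ n - X j ^ n : CoordRing N) ∣ fermatPoly N n := by
  have key : ∀ {i j : Fin (N + 1)}, i < j →
      (X i ^ n - X j ^ n : CoordRing N) ∣ fermatPoly N n := fun {i j} h =>
    (Finset.dvd_prod_of_mem (fun j => (X i ^ n - X j ^ n : CoordRing N))
      (Finset.mem_Ioi.2 h)).trans
      (Finset.dvd_prod_of_mem
        (fun i => ∏ j ∈ Finset.Ioi i, (X i ^ n - X j ^ n : CoordRing N)) (Finset.mem_univ i))
  rcases lt_or_gt_of_ne hij with h | h
  · exact key h
  · rw [← neg_sub, neg_dvd]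
    exact key h

theorem fermatPoly_ne_zero (N : ℕ) {n : ℕ} (hn : n ≠ 0) : fermatPoly N n ≠ 0 := by
  refine Finset.prod_ne_zero_iff.2 fun i _ => Finset.prod_ne_zero_iff.2 fun j hj h => ?_
  have hij : i ≠ j := (Finset.mem_Ioi.1 hj).ne
  have := congrArg (eval (Pi.single i (1 : ℂ))) h
  simp [hij.symm, hn] at this

theorem irreducible_of_isHomogeneous_one {σ K : Type*} [Field K] {l : MvPolynomial σ K}
    (h0 : l ≠ 0) (h1 : l.IsHomogeneous 1) : Irreducible l := by
  refine irreducible_of_totalDegree_eq_one (h1.totalDegree h0) fun x hx => ?_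
  obtain ⟨i, hi⟩ := ne_zero_iff.1 h0
  refine isUnit_iff_ne_zero.2 ?_
  rintro rfl
  exact hi (zero_dvd_iff.1 (hx i))

/-- A linear form dividing `F` is irreducible, hence associated to one of the finitely many
irreducible factors, and associates have the same zero locus. -/
theorem finite_fermatArrangement (N : ℕ) {n : ℕ} (hn : n ≠ 0) :
    (fermatArrangement N n).Finite := by
  classical
  have hF := fermatPoly_ne_zero N hn
  refine ((UniqueFactorizationMonoid.factors (fermatPoly N n)).toFinset.finite_toSet.biUnion
    (t := fun q => {H | ∀ v, v ∈ H ↔ eval v q = 0}) fun q _ => ?_).subset ?_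
  · refine Set.Subsingleton.finite fun H hH H' hH' => ?_
    ext v
    rw [hH v, hH' v]
  · rintro H ⟨l, h0, h1, hd, hl⟩
    obtain ⟨q, hq, u, hu⟩ := UniqueFactorizationMonoid.exists_mem_factors_of_dvd hF
      (irreducible_of_isHomogeneous_one h0 h1) hd
    refine Set.mem_biUnion (by simpa using hq) fun v => ?_
    have hv : IsUnit (eval v (u : CoordRing N)) := u.isUnit.map (eval v)
    rw [hl v, ← hu, map_mul, hv.mul_left_eq_zero]

theorem lt_top_of_mem_fermatArrangement {N n : ℕ} {H : Submodule ℂ (Fin (N + 1) → ℂ)}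
    (hH : H ∈ fermatArrangement N n) : H < ⊤ := by
  obtain ⟨l, h0, -, -, hl⟩ := hH
  refine lt_top_iff_ne_top.2 ?_
  rintro rfl
  exact h0 (MvPolynomial.funext fun v => by simpa using hl v)

/-- Two distinct proper hyperplanes form a strict chain `H₁ ⊓ H₂ < H < ⊤` with one of them, so their
intersection has codimension at least 2 and cannot exceed `W`. This bounds the number of flats. -/
theorem exists_inf_eq_of_mem_fermatFlats {N n : ℕ} {W : Submodule ℂ (Fin (N + 1) → ℂ)}
    (hW : W ∈ fermatFlats N n) :
    ∃ H₁ ∈ fermatArrangement N n, ∃ H₂ ∈ fermatArrangement N n, H₁ ⊓ H₂ = W := by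
  obtain ⟨hdim, hcard⟩ := hW
  obtain ⟨H₁, ⟨h₁, hW₁⟩, H₂, ⟨h₂, hW₂⟩, hne⟩ := Set.one_lt_encard_iff_nontrivial.1
    (lt_of_lt_of_le (by norm_num) hcard)
  refine ⟨H₁, h₁, H₂, h₂, (Submodule.eq_of_le_of_finrank_le (le_inf hW₁ hW₂) ?_).symm⟩
  have key : ∀ H ∈ fermatArrangement N n, H₁ ⊓ H₂ < H →
      Module.finrank ℂ ↥(H₁ ⊓ H₂) ≤ Module.finrank ℂ W := fun H hH hlt => by
    have a := Submodule.finrank_lt_finrank_of_lt hlt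
    have b := Submodule.finrank_lt_finrank_of_lt (lt_top_of_mem_fermatArrangement hH)
    rw [finrank_top, Module.finrank_fin_fun] at b
    omega
  rcases (inf_le_left : H₁ ⊓ H₂ ≤ H₁).lt_or_eq with h | h
  · exact key H₁ h₁ h
  · exact key H₂ h₂ (h.symm ▸ lt_of_le_of_ne (inf_eq_left.1 h) hne)

theorem finite_fermatFlats (N : ℕ) {n : ℕ} (hn : n ≠ 0) : (fermatFlats N n).Finite :=
  ((finite_fermatArrangement N hn).image2 (· ⊓ ·) (finite_fermatArrangement N hn)).subset
    fun _ hW => by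
      obtain ⟨H₁, h₁, H₂, h₂, rfl⟩ := exists_inf_eq_of_mem_fermatFlats hW
      exact Set.mem_image2_of_mem h₁ h₂

/-! ### Membership in the ideal of the flats -/

theorem mem_fermatIdeal_iff {N n : ℕ} {p : CoordRing N} :
    p ∈ fermatIdeal N n ↔ ∀ W ∈ fermatFlats N n, ∀ v ∈ W, v ≠ 0 → eval v p = 0 := by
  simp only [fermatIdeal, idealOf, mem_vanishingIdeal_iff, fermatLocus, Set.mem_ofPred_eq,
    Projectivization.submodule_mk, Submodule.span_singleton_le_iff_mem, aeval_eq_eval]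
  exact ⟨fun h W hW v hv h0 => h v ⟨h0, W, hW, hv⟩, fun h v ⟨h0, W, hW, hv⟩ => h W hW v hv h0⟩

theorem mem_fermatIdeal_of_sq_mem {N n : ℕ} {p : CoordRing N} (hp : p * p ∈ fermatIdeal N n) :
    p ∈ fermatIdeal N n := by
  rw [mem_fermatIdeal_iff] at hp ⊢
  intro W hW v hv h0
  simpa using hp W hW v hv h0

/-- A prime ideal that contains the ideal of the flats contains the ideal of one of them. -/
theorem exists_flat_of_fermatIdeal_le {N n : ℕ} (hn : n ≠ 0) {P : Ideal (CoordRing N)}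
    (hP : P.IsPrime) (hle : fermatIdeal N n ≤ P) :
    ∃ W ∈ fermatFlats N n, vanishingIdeal ℂ (W : Set (Fin (N + 1) → ℂ)) ≤ P := by
  have hinf : (finite_fermatFlats N hn).toFinset.inf
      (fun W => vanishingIdeal ℂ (W : Set (Fin (N + 1) → ℂ))) ≤ fermatIdeal N n := by
    intro p hp
    rw [mem_fermatIdeal_iff]
    intro W hW v hv _
    exact Submodule.mem_finsetInf.1 hp W (by simpa using hW) v hv
  obtain ⟨W, hW, h⟩ := hP.inf_le'.1 (hinf.trans hle)
  exact ⟨W, by simpa using hW, h⟩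

theorem mul_mul_dvd_of_prime {R : Type*} [CommRing R] [IsDomain R] {a b c f : R}
    (hb : Prime b) (hc : Prime c) (hba : ¬ b ∣ a) (hca : ¬ c ∣ a) (hcb : ¬ c ∣ b)
    (haf : a ∣ f) (hbf : b ∣ f) (hcf : c ∣ f) : a * b * c ∣ f := by
  obtain ⟨g, rfl⟩ := haf
  obtain ⟨k, rfl⟩ := (hb.dvd_or_dvd hbf).resolve_left hba
  obtain ⟨m, rfl⟩ := (hc.dvd_or_dvd ((hc.dvd_or_dvd hcf).resolve_left hca)).resolve_left hcb
  exact ⟨m, by ring⟩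

theorem fermatPoly_mem_pow_three_of_fermatIdeal_le {N n : ℕ} (hn : n ≠ 0)
    {P : Ideal (CoordRing N)} (hP : P.IsPrime) (hle : fermatIdeal N n ≤ P) :
    fermatPoly N n ∈ P ^ 3 := by
  obtain ⟨W, ⟨-, hcard⟩, hWP⟩ := exists_flat_of_fermatIdeal_le hn hP hle
  obtain ⟨t, ht, htc⟩ := Set.exists_subset_encard_eq hcard
  obtain ⟨H₁, H₂, H₃, h12, h13, h23, rfl⟩ := Set.encard_eq_three.1 htc
  obtain ⟨⟨l₁, z₁, d₁, f₁, e₁⟩, w₁⟩ := ht (show H₁ ∈ _ by simp)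
  obtain ⟨⟨l₂, z₂, d₂, f₂, e₂⟩, w₂⟩ := ht (show H₂ ∈ _ by simp)
  obtain ⟨⟨l₃, z₃, d₃, f₃, e₃⟩, w₃⟩ := ht (show H₃ ∈ _ by simp)
  have i₁ := irreducible_of_isHomogeneous_one z₁ d₁
  have i₂ := irreducible_of_isHomogeneous_one z₂ d₂
  have i₃ := irreducible_of_isHomogeneous_one z₃ d₃
  -- Irreducibles dividing one another are associated and would cut out the same hyperplane.
  have key : ∀ {l l' : CoordRing N} {H H' : Submodule ℂ (Fin (N + 1) → ℂ)},
      Irreducible l → Irreducible l' → (∀ v, v ∈ H ↔ eval v l = 0) →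
      (∀ v, v ∈ H' ↔ eval v l' = 0) → H ≠ H' → ¬ l' ∣ l := by
    intro l l' H H' hl hl' h h' hne hd
    obtain ⟨u, hu⟩ := hl'.associated_of_dvd hl hd
    refine hne (Submodule.ext fun v => ?_)
    have hv : IsUnit (eval v (u : CoordRing N)) := u.isUnit.map (eval v)
    rw [h, h', ← hu, map_mul, hv.mul_left_eq_zero]
  have hd := mul_mul_dvd_of_prime i₂.prime i₃.prime (key i₁ i₂ e₁ e₂ h12) (key i₁ i₃ e₁ e₃ h13)
    (key i₂ i₃ e₂ e₃ h23) f₁ f₂ f₃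
  refine Ideal.mem_of_dvd _ hd ?_
  rw [pow_succ, pow_two]
  exact Ideal.mul_mem_mul (Ideal.mul_mem_mul (hWP fun v hv => (e₁ v).1 (w₁ hv))
    (hWP fun v hv => (e₂ v).1 (w₂ hv))) (hWP fun v hv => (e₃ v).1 (w₃ hv))

/-! ### Associated primes and symbolic powers of radical ideals -/

/-- An associated prime `P` of a radical ideal `I` is generically equal to `I`: some element
outside of `P` multiplies `P` into `I`. -/
theorem exists_notMem_mul_mem_of_mem_associatedPrimes {R : Type*} [CommRing R]
    [IsNoetherianRing R] {I P : Ideal R} (hI : ∀ r, r * r ∈ I → r ∈ I)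
    (hP : P ∈ associatedPrimes R (R ⧸ I)) : ∃ r ∉ P, ∀ p, p ∈ P ↔ r * p ∈ I := by
  obtain ⟨hprime, x, hx⟩ := isAssociatedPrime_iff.1 hP
  obtain ⟨r, rfl⟩ := Ideal.Quotient.mk_surjective x
  have hmem : ∀ p, p ∈ P ↔ r * p ∈ I := fun p => by
    rw [hx, Submodule.mem_colon_singleton, Submodule.mem_bot, ← Ideal.Quotient.eq_zero_iff_mem,
      mul_comm, map_mul, Algebra.smul_def]
    rfl
  refine ⟨r, fun hr => hprime.ne_top ((Ideal.eq_top_iff_one P).2 ((hmem 1).2 ?_)), hmem⟩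
  rw [mul_one]
  exact hI r ((hmem r).1 hr)

theorem le_of_mem_associatedPrimes {R : Type*} [CommRing R] {I P : Ideal R}
    (hP : P ∈ associatedPrimes R (R ⧸ I)) : I ≤ P := by
  simpa [Submodule.annihilator_top, Ideal.annihilator_quotient] using hP.annihilator_le

/-- For a radical ideal, the symbolic power contains the intersection of the powers of the
associated primes. -/
theorem mem_symbolicPower {R : Type*} [CommRing R] [IsNoetherianRing R] {I : Ideal R}
    (hI : ∀ r, r * r ∈ I → r ∈ I) {m : ℕ} {f : R}
    (hf : ∀ P ∈ associatedPrimes R (R ⧸ I), f ∈ P ^ m) : f ∈ symbolicPower I m := by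
  refine Submodule.mem_iInf _ |>.2 fun P => ?_
  obtain ⟨r, hr, hmem⟩ := exists_notMem_mul_mem_of_mem_associatedPrimes hI P.2
  rw [Ideal.mem_comap, IsLocalization.algebraMap_mem_map_algebraMap_iff P.1.primeCompl]
  refine ⟨r ^ m, pow_mem (S := P.1.primeCompl) hr m, ?_⟩
  -- Raising `rP ⊆ I` to the `m`-th power shows that `r^m`, a unit in the localization, multiplies
  -- `P^m` into `I^m`.
  have hle : Ideal.span {r} * P.1 ≤ I :=
    Ideal.span_singleton_mul_le_iff.2 fun p hp => (hmem p).1 hp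
  have := Ideal.pow_right_mono hle m
  rw [mul_pow, Ideal.span_singleton_pow] at this
  exact this (Ideal.mul_mem_mul (Ideal.mem_span_singleton_self _) (hf P.1 P.2))

/-! ### Coefficients of polynomials vanishing at the Fermat points of the plane -/

/-- A polynomial in `t` vanishing at all nonzero `t` is zero; the sum is its coefficient of degree
`k`. -/
theorem sum_filter_eq_zero_of_sum_mul_pow_eq_zero {ι : Type*} (s : Finset ι) (c : ι → ℂ)
    (d : ι → ℕ) (h : ∀ t : ℂ, t ≠ 0 → ∑ m ∈ s, c m * t ^ d m = 0) (k : ℕ) :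
    ∑ m ∈ s with d m = k, c m = 0 := by
  have hW : (∑ m ∈ s, Polynomial.C (c m) * Polynomial.X ^ d m : Polynomial ℂ) = 0 := by
    refine Polynomial.eq_zero_of_infinite_isRoot _ (Set.Infinite.mono ?_
      (Set.finite_singleton (0 : ℂ)).infinite_compl)
    intro t ht
    simpa [Polynomial.IsRoot, Polynomial.eval_finsetSum] using h t ht
  have := congrArg (fun p => Polynomial.coeff p k) hW
  simp only [Polynomial.finsetSum_coeff, Polynomial.coeff_C_mul_X_pow,
    Polynomial.coeff_zero] at this
  rw [Finset.sum_filter]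
  simpa [eq_comm] using this

/-- Orthogonality of the characters of `ℤ/n`, by summing a geometric series. -/
theorem _root_.IsPrimitiveRoot.sum_pow_mul_inv_pow {ζ : ℂ} {n : ℕ} (hζ : IsPrimitiveRoot ζ n)
    (k a : ℕ) :
    ∑ s ∈ Finset.range n, (ζ ^ s) ^ k * ((ζ ^ s) ^ a)⁻¹ = if k ≡ a [MOD n] then (n : ℂ) else 0 := by
  rcases Nat.eq_zero_or_pos n with rfl | hn
  · simp
  have h0 : ζ ≠ 0 := hζ.ne_zero hn.ne'
  have hterm : ∀ s, (ζ ^ s) ^ k * ((ζ ^ s) ^ a)⁻¹ = (ζ ^ k * (ζ ^ a)⁻¹) ^ s := fun s => by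
    rw [mul_pow, inv_pow, ← pow_mul, ← pow_mul, ← pow_mul, ← pow_mul, mul_comm s k, mul_comm s a]
  simp only [hterm]
  have hmod : ζ ^ k * (ζ ^ a)⁻¹ = 1 ↔ k ≡ a [MOD n] := by
    have h := pow_eq_pow_iff_modEq (x := Units.mk0 ζ h0) (n := k) (m := a)
    rw [← orderOf_units, Units.val_mk0, ← hζ.eq_orderOf, ← Units.val_inj] at h
    rw [mul_inv_eq_one₀ (pow_ne_zero _ h0)]
    simpa using h
  split_ifs with h
  · simp [hmod.2 h]
  · rw [geom_sum_eq (mt hmod.1 h), mul_pow, inv_pow, ← pow_mul, ← pow_mul, mul_comm k,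
      mul_comm a, pow_mul, pow_mul, hζ.pow_eq_one]
    simp

/-- The polynomial `p` in three variables vanishes at the points of `ℙ²` in the Fermat
configuration of multiple points. -/
def VanishesAtFermatPoints (n : ℕ) (p : MvPolynomial (Fin 3) ℂ) : Prop :=
  (∀ α β t : ℂ, α ^ n = 1 → β ^ n = 1 → t ≠ 0 → eval ![t * α, t * β, t] p = 0) ∧
    ∀ (i : Fin 3) (t : ℂ), t ≠ 0 → eval (Pi.single i t) p = 0

namespace VanishesAtFermatPoints

variable {n : ℕ} {p q : MvPolynomial (Fin 3) ℂ}

/-- Averaging the values at `(tα, tβ, t)` against `α^(-a) β^(-b)` isolates the residue classes of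
the first two exponents; letting `t` vary isolates the degree. -/
theorem sum_coeff_eq_zero (hp : VanishesAtFermatPoints n p) (hn : n ≠ 0) (a b d : ℕ) :
    ∑ m ∈ p.support with m 0 + m 1 + m 2 = d ∧ m 0 ≡ a [MOD n] ∧ m 1 ≡ b [MOD n],
      coeff m p = 0 := by
  have hζ := Complex.isPrimitiveRoot_exp n hn
  set ζ := Complex.exp (2 * Real.pi * Complex.I / n)
  have key := sum_filter_eq_zero_of_sum_mul_pow_eq_zero p.support
    (fun m => coeff m p * ((if m 0 ≡ a [MOD n] then (n : ℂ) else 0) *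
      (if m 1 ≡ b [MOD n] then (n : ℂ) else 0))) (fun m => m 0 + m 1 + m 2) (fun t ht => ?_) d
  · have hn' : (n : ℂ) ≠ 0 := Nat.cast_ne_zero.2 hn
    refine (mul_eq_zero.1 (?_ : (n : ℂ) * n * _ = 0)).resolve_left (mul_ne_zero hn' hn')
    rw [← key, ← Finset.filter_filter, Finset.sum_filter _ _, Finset.mul_sum]
    refine Finset.sum_congr rfl fun m _ => ?_
    by_cases h0 : m 0 ≡ a [MOD n] <;> by_cases h1 : m 1 ≡ b [MOD n] <;> simp [h0, h1]
    ring
  · have : ∀ s ∈ Finset.range n, ∀ s' ∈ Finset.range n,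
        ((ζ ^ s) ^ a)⁻¹ * ((ζ ^ s') ^ b)⁻¹ * eval ![t * ζ ^ s, t * ζ ^ s', t] p = 0 := by
      intro s _ s' _
      rw [hp.1 _ _ t _ _ ht, mul_zero] <;> rw [← pow_mul, mul_comm, pow_mul, hζ.pow_eq_one, one_pow]
    refine Eq.trans ?_ (Finset.sum_eq_zero fun s hs => Finset.sum_eq_zero (this s hs))
    simp only [← hζ.sum_pow_mul_inv_pow, eval_eq', Fin.prod_univ_three, Finset.mul_sum,
      Finset.sum_mul]
    rw [Finset.sum_congr rfl fun s _ => Finset.sum_comm, Finset.sum_comm]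
    refine Finset.sum_congr rfl fun m _ => ?_
    rw [Finset.sum_comm]
    refine Finset.sum_congr rfl fun s _ => Finset.sum_congr rfl fun s' _ => ?_
    simp only [Matrix.cons_val]
    ring

/-- On a coordinate axis only the pure powers of that variable survive, giving a polynomial in `t`
with these coefficients. -/
theorem coeff_single (hp : VanishesAtFermatPoints n p) (i : Fin 3) (k : ℕ) :
    coeff (Finsupp.single i k) p = 0 := by
  have key := sum_filter_eq_zero_of_sum_mul_pow_eq_zero
    (p.support.filter fun m => m = Finsupp.single i (m i)) (fun m => coeff m p) (fun m => m i)
    (fun t ht => ?_) k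
  · by_contra h
    refine h (Eq.trans ?_ key)
    rw [Finset.sum_eq_single (Finsupp.single i k)]
    · intro m hm hne
      simp only [Finset.mem_filter] at hm
      exact absurd (hm.2 ▸ hm.1.2) hne
    · intro hm
      simp only [Finset.mem_filter, mem_support_iff, Finsupp.single_eq_same, and_true] at hm
      simpa using hm
  · rw [← hp.2 i t ht, eval_eq', Finset.sum_filter]
    refine Finset.sum_congr rfl fun m _ => ?_
    split_ifs with h
    · congr 1
      rw [Finset.prod_eq_single i]
      · simp
      · intro j _ hj
        rw [h]
        simp [hj.symm]
      · simp
    · have : ∃ j, j ≠ i ∧ m j ≠ 0 := by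
        by_contra! hcon
        refine h (Finsupp.ext fun j => ?_)
        by_cases hj : j = i
        · simp [hj]
        · rw [hcon j hj, Finsupp.single_eq_of_ne hj]
      obtain ⟨j, hj, hmj⟩ := this
      rw [Finset.prod_eq_zero (Finset.mem_univ j), mul_zero]
      simp [hj, hmj]

theorem ext_three {m m' : Fin 3 →₀ ℕ} (h0 : m 0 = m' 0) (h1 : m 1 = m' 1) (h2 : m 2 = m' 2) :
    m = m' := by
  ext i
  fin_cases i <;> assumption

theorem eq_or_add_le_of_modEq {k a : ℕ} (h : k ≡ a [MOD n]) (ha : a < n) :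
    k = a ∨ a + n ≤ k := by
  have h' : k % n = a := by rw [h, Nat.mod_eq_of_lt ha]
  have := Nat.div_add_mod k n
  rcases Nat.eq_zero_or_pos (k / n) with hk | hk
  · left
    rw [hk] at this
    omega
  · right
    have := Nat.le_mul_of_pos_right n hk
    omega

/-- The relation from `sum_coeff_eq_zero` has a single term: raising an exponent by `n` would exceed
the total degree `a + b`. -/
theorem coeff_zero_one (hp : VanishesAtFermatPoints n p) {a b : ℕ} (ha : a < n) (hb : b < n) :
    coeff (Finsupp.single 0 a + Finsupp.single 1 b) p = 0 := by
  by_contra h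
  refine h (Eq.trans ?_ (hp.sum_coeff_eq_zero (by omega) a b (a + b)))
  symm
  refine Finset.sum_eq_single _ (fun m hm hne => ?_) fun hm => ?_
  · simp only [Finset.mem_filter] at hm
    obtain ⟨-, hd, h0, h1⟩ := hm
    refine absurd (ext_three ?_ ?_ ?_) hne <;>
    rcases eq_or_add_le_of_modEq h0 ha with h0 | h0 <;>
    rcases eq_or_add_le_of_modEq h1 hb with h1 | h1 <;> simp <;> omega
  · simp [Nat.ModEq.refl] at hm
    exact hm

theorem coeff_zero_two (hp : VanishesAtFermatPoints n p) {a b : ℕ} (ha : a < n) (hb : b < n) :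
    coeff (Finsupp.single 0 a + Finsupp.single 2 b) p = 0 := by
  by_contra h
  refine h (Eq.trans ?_ (hp.sum_coeff_eq_zero (by omega) a 0 (a + b)))
  symm
  refine Finset.sum_eq_single _ (fun m hm hne => ?_) fun hm => ?_
  · simp only [Finset.mem_filter] at hm
    obtain ⟨-, hd, h0, h1⟩ := hm
    refine absurd (ext_three ?_ ?_ ?_) hne <;>
    rcases eq_or_add_le_of_modEq h0 ha with h0 | h0 <;>
    rcases eq_or_add_le_of_modEq h1 (by omega) with h1 | h1 <;> simp <;> omega
  · simp [Nat.ModEq.refl] at hm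
    exact hm

/-- In degree `a + n` with residues `(a, 0)` there are just three monomials: `x^a y^n`, `x^a z^n`
and the pure power `x^(a+n)`, whose coefficient vanishes. -/
theorem coeff_add_coeff (hp : VanishesAtFermatPoints n p) {a : ℕ} (ha : a < n) :
    coeff (Finsupp.single 0 a + Finsupp.single 1 n) p +
      coeff (Finsupp.single 0 a + Finsupp.single 2 n) p = 0 := by
  classical
  have key := hp.sum_coeff_eq_zero (by omega) a 0 (a + n)
  have hne : (Finsupp.single 0 a + Finsupp.single 1 n : Fin 3 →₀ ℕ) ≠
      Finsupp.single 0 a + Finsupp.single 2 n := fun h => by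
    have := DFunLike.congr_fun h 1
    simp at this
    omega
  rw [← key, ← Finset.sum_pair (f := fun m => coeff m p) hne]
  refine (Finset.sum_congr_of_eq_on_inter (fun m hm hnot => ?_) (fun m hm hnot => ?_)
    fun _ _ _ => rfl).symm
  · simp only [Finset.mem_filter, Finset.mem_insert, Finset.mem_singleton, not_or] at hm hnot
    obtain ⟨-, hd, h0, h1⟩ := hm
    rcases eq_or_add_le_of_modEq h0 ha with h0 | h0
    · rcases eq_or_add_le_of_modEq h1 (by omega) with h1 | h1
      · exact absurd (ext_three (by simp; omega) (by simp; omega) (by simp; omega)) hnot.2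
      · exact absurd (ext_three (by simp; omega) (by simp; omega) (by simp; omega)) hnot.1
    · rw [ext_three (m := m) (m' := Finsupp.single 0 (a + n)) (by simp; omega) (by simp; omega)
        (by simp; omega)]
      exact hp.coeff_single _ _
  · simp only [Finset.mem_insert, Finset.mem_singleton] at hm
    by_contra hc
    refine hnot (Finset.mem_filter.2 ⟨mem_support_iff.2 hc, ?_⟩)
    rcases hm with rfl | rfl <;> simp [Nat.ModEq]

/-- The coefficient of `x^n y^{2n}` of a product, where `y` is one of the last two variables. -/
theorem coeff_mul (hp : VanishesAtFermatPoints n p) (hq : VanishesAtFermatPoints n q)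
    {j : Fin 3} (hj : j ≠ 0)
    (hp' : ∀ a b, a < n → b < n → coeff (Finsupp.single 0 a + Finsupp.single j b) p = 0)
    (hq' : ∀ a b, a < n → b < n → coeff (Finsupp.single 0 a + Finsupp.single j b) q = 0) :
    coeff (Finsupp.single 0 n + Finsupp.single j (2 * n)) (p * q) =
      ∑ a ∈ Finset.range n, coeff (Finsupp.single 0 a + Finsupp.single j n) p *
        coeff (Finsupp.single 0 (n - a) + Finsupp.single j n) q := by
  rw [MvPolynomial.coeff_mul]
  symm
  refine Finset.sum_of_injOn (fun a => (Finsupp.single 0 a + Finsupp.single j n,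
    Finsupp.single 0 (n - a) + Finsupp.single j n)) ?_ ?_ ?_ fun _ _ => rfl
  · intro a _ a' _ h
    have := DFunLike.congr_fun (Prod.ext_iff.1 h).1 0
    simpa [hj.symm] using this
  · intro a ha
    have ha := Finset.mem_range.1 ha
    simp only [Finset.mem_coe, Finset.HasAntidiagonal.mem_antidiagonal]
    rw [add_add_add_comm, ← Finsupp.single_add, ← Finsupp.single_add]
    congr 2 <;> omega
  · rintro ⟨u, v⟩ huv hnot
    rw [Finset.HasAntidiagonal.mem_antidiagonal] at huv
    have h0 : u 0 + v 0 = n := by simpa [hj.symm] using DFunLike.congr_fun huv 0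
    have h1 : u j + v j = 2 * n := by simpa [hj] using DFunLike.congr_fun huv j
    have h2 : ∀ i, i ≠ 0 → i ≠ j → u i = 0 ∧ v i = 0 := fun i hi hij => by
      simpa [hi, hij] using DFunLike.congr_fun huv i
    have hu : u = Finsupp.single 0 (u 0) + Finsupp.single j (u j) := by
      ext i
      by_cases hi : i = 0
      · simp [hi, hj.symm]
      by_cases hij : i = j
      · simp [hij, hj]
      simp [hi, hij, h2 i hi hij]
    have hv : v = Finsupp.single 0 (v 0) + Finsupp.single j (v j) := by
      ext i
      by_cases hi : i = 0
      · simp [hi, hj.symm]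
      by_cases hij : i = j
      · simp [hij, hj]
      simp [hi, hij, h2 i hi hij]
    simp only
    rcases Nat.eq_zero_or_pos (v 0) with hv0 | hv0
    · rw [hv, hv0, Finsupp.single_zero, zero_add, hq.coeff_single, mul_zero]
    rcases Nat.eq_zero_or_pos (u 0) with hu0 | hu0
    · rw [hu, hu0, Finsupp.single_zero, zero_add, hp.coeff_single, zero_mul]
    -- Both exponents of `x` now lie strictly between `0` and `n`, so unless both exponents of `x_j`
    -- equal `n`, the factor with the smaller one has coefficient zero.
    rcases lt_trichotomy (u j) n with hlt | heq | hgt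
    · rw [hu, hp' _ _ (by omega) hlt, zero_mul]
    · refine absurd ⟨u 0, by simp; omega, ?_⟩ hnot
      ext1
      · simp only
        rw [← heq, ← hu]
      · simp only
        rw [show n - u 0 = v 0 by omega]
        conv_lhs => rw [show n = v j by omega]
        exact hv.symm
    · rw [hv, hq' _ _ (by omega) (by omega), mul_zero]

theorem coeff_mul_eq (hp : VanishesAtFermatPoints n p) (hq : VanishesAtFermatPoints n q) :
    coeff (Finsupp.single 0 n + Finsupp.single 1 (2 * n)) (p * q) =
      coeff (Finsupp.single 0 n + Finsupp.single 2 (2 * n)) (p * q) := by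
  rw [hp.coeff_mul hq (by decide) (fun _ _ => hp.coeff_zero_one) fun _ _ => hq.coeff_zero_one,
    hp.coeff_mul hq (by decide) (fun _ _ => hp.coeff_zero_two) fun _ _ => hq.coeff_zero_two]
  refine Finset.sum_congr rfl fun a ha => ?_
  have ha := Finset.mem_range.1 ha
  rcases Nat.eq_zero_or_pos a with rfl | ha0
  · simp [hp.coeff_single]
  · rw [eq_neg_of_add_eq_zero_left (hp.coeff_add_coeff ha),
      eq_neg_of_add_eq_zero_left (hq.coeff_add_coeff (show n - a < n by omega)), neg_mul_neg]

end VanishesAtFermatPoints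

/-! ### Explicit flats -/

/-- The linear hyperplane `x_i = α x_j`. -/
noncomputable def coordHyperplane {N : ℕ} (i j : Fin (N + 1)) (α : ℂ) :
    Submodule ℂ (Fin (N + 1) → ℂ) :=
  LinearMap.ker (LinearMap.proj i - α • LinearMap.proj j : (Fin (N + 1) → ℂ) →ₗ[ℂ] ℂ)

@[simp]
theorem mem_coordHyperplane {N : ℕ} {i j : Fin (N + 1)} {α : ℂ} {v : Fin (N + 1) → ℂ} :
    v ∈ coordHyperplane i j α ↔ v i = α * v j := by
  simp [coordHyperplane, sub_eq_zero]

theorem coordHyperplane_mem_fermatArrangement {N n : ℕ} {i j : Fin (N + 1)} (hij : i ≠ j)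
    {α : ℂ} (hα : α ^ n = 1) : coordHyperplane i j α ∈ fermatArrangement N n := by
  refine ⟨X i - C α * X j, fun h => ?_, ?_, ?_, fun v => ?_⟩
  · have := congrArg (eval (Pi.single i (1 : ℂ))) h
    simp [hij.symm] at this
  · exact (isHomogeneous_X _ _).sub (isHomogeneous_C_mul_X _ _)
  · refine dvd_trans ?_ (X_pow_sub_X_pow_dvd_fermatPoly hij)
    convert sub_dvd_pow_sub_pow (X i : CoordRing N) (C α * X j) n using 2
    rw [mul_pow, ← C_pow, hα, C_1, one_mul]
  · simp [sub_eq_zero]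

theorem finrank_coordHyperplane_inf {N : ℕ} {i j k : Fin (N + 1)} (hij : i ≠ j) (hik : i ≠ k)
    (hjk : j ≠ k) (α β : ℂ) :
    Module.finrank ℂ ↥(coordHyperplane i k α ⊓ coordHyperplane j k β) + 2 = N + 1 := by
  rw [coordHyperplane, coordHyperplane, ← LinearMap.ker_prod]
  set f : (Fin (N + 1) → ℂ) →ₗ[ℂ] ℂ × ℂ :=
    (LinearMap.proj i - α • LinearMap.proj k : (Fin (N + 1) → ℂ) →ₗ[ℂ] ℂ).prod
      (LinearMap.proj j - β • LinearMap.proj k)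
  have hf : LinearMap.range f = ⊤ := LinearMap.range_eq_top.2 fun ⟨a, b⟩ =>
    ⟨Pi.single i a + Pi.single j b, by simp [f, hij, hij.symm, hik.symm, hjk.symm]⟩
  have := f.finrank_range_add_finrank_ker
  rw [hf, finrank_top, Module.finrank_prod, Module.finrank_self, Module.finrank_fin_fun] at this
  omega

theorem three_le_encard {α : Type*} {s : Set α} {a b c : α} (ha : a ∈ s) (hb : b ∈ s) (hc : c ∈ s)
    (hab : a ≠ b) (hac : a ≠ c) (hbc : b ≠ c) : 3 ≤ s.encard := by
  rw [← Set.encard_eq_three.2 ⟨a, b, c, hab, hac, hbc, rfl⟩]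
  refine Set.encard_le_encard ?_
  rintro x (rfl | rfl | rfl) <;> assumption

/-- The flat `x_i = α x_k`, `x_j = β x_k`, contained in the hyperplane `x_i = α β⁻¹ x_j`. -/
theorem flat_of_roots_of_unity {N n : ℕ} (hn : n ≠ 0) {i j k : Fin (N + 1)} (hij : i ≠ j)
    (hik : i ≠ k) (hjk : j ≠ k) {α β : ℂ} (hα : α ^ n = 1) (hβ : β ^ n = 1) :
    coordHyperplane i k α ⊓ coordHyperplane j k β ∈ fermatFlats N n := by
  have hβ0 : β ≠ 0 := by
    rintro rfl
    simp [hn] at hβ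
  have hα0 : α ≠ 0 := by
    rintro rfl
    simp [hn] at hα
  refine ⟨finrank_coordHyperplane_inf hij hik hjk α β, three_le_encard
    (a := coordHyperplane i k α) (b := coordHyperplane j k β) (c := coordHyperplane i j (α * β⁻¹))
    ⟨coordHyperplane_mem_fermatArrangement hik hα, inf_le_left⟩
    ⟨coordHyperplane_mem_fermatArrangement hjk hβ, inf_le_right⟩
    ⟨coordHyperplane_mem_fermatArrangement hij (by simp [mul_pow, hα, hβ]), ?_⟩ ?_ ?_ ?_⟩
  · rintro v ⟨h1, h2⟩
    rw [SetLike.mem_coe, mem_coordHyperplane] at h1 h2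
    rw [mem_coordHyperplane, h1, h2]
    field_simp
  -- The three hyperplanes are told apart by the basis vectors `e_j`, `e_j` and `e_i`.
  · intro h
    have := SetLike.ext_iff.1 h (Pi.single j 1)
    simp [hij, hjk.symm] at this
  · intro h
    have := SetLike.ext_iff.1 h (Pi.single j 1)
    simp [hij, hjk.symm, hα0, hβ0] at this
  · intro h
    have := SetLike.ext_iff.1 h (Pi.single i 1)
    simp [hij.symm, hik.symm] at this

theorem coordHyperplane_injective {N : ℕ} {i j : Fin (N + 1)} (hij : i ≠ j) :
    Function.Injective (coordHyperplane i j) := fun α β h => by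
  have := SetLike.ext_iff.1 h (Pi.single i α + Pi.single j 1)
  simpa [hij, hij.symm] using this

/-- The flat `x_i = x_j = 0`, contained in all hyperplanes `x_i = ζ x_j`. -/
theorem flat_of_coordinates {N n : ℕ} (hn : 3 ≤ n) {i j k : Fin (N + 1)} (hij : i ≠ j)
    (hik : i ≠ k) (hjk : j ≠ k) :
    coordHyperplane i k 0 ⊓ coordHyperplane j k 0 ∈ fermatFlats N n := by
  have hζ := Complex.isPrimitiveRoot_exp n (by omega)
  set ζ := Complex.exp (2 * Real.pi * Complex.I / n)
  have hmem : ∀ a : ℕ, coordHyperplane i j (ζ ^ a) ∈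
      {H ∈ fermatArrangement N n | coordHyperplane i k 0 ⊓ coordHyperplane j k 0 ≤ H} := by
    refine fun a => ⟨coordHyperplane_mem_fermatArrangement hij
      (by rw [← pow_mul, mul_comm, pow_mul, hζ.pow_eq_one, one_pow]), ?_⟩
    rintro v ⟨h1, h2⟩
    rw [SetLike.mem_coe, mem_coordHyperplane, zero_mul] at h1 h2
    rw [mem_coordHyperplane, h1, h2, mul_zero]
  have hne : ∀ a b : ℕ, a < n → b < n → a ≠ b →
      coordHyperplane i j (ζ ^ a) ≠ coordHyperplane i j (ζ ^ b) := fun a b ha hb hab h =>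
    hab (hζ.pow_inj ha hb (coordHyperplane_injective hij h))
  -- The assumption `3 ≤ n` is essential here: it makes `1`, `ζ`, `ζ^2` distinct.
  exact ⟨finrank_coordHyperplane_inf hij hik hjk 0 0, three_le_encard (hmem 0) (hmem 1) (hmem 2)
    (hne _ _ (by omega) (by omega) (by omega)) (hne _ _ (by omega) (by omega) (by omega))
    (hne _ _ (by omega) (by omega) (by omega))⟩

/-! ### Restriction to a three-dimensional affine subspace -/

/-- The substitution that keeps the first three variables and replaces the others by the
constants `1, 2, …`. -/
noncomputable def restrictVar (M : ℕ) : Fin (M + 3) → MvPolynomial (Fin 3) ℂ :=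
  Fin.cons (X 0) (Fin.cons (X 1) (Fin.cons (X 2) fun k => C ((k : ℂ) + 1)))

noncomputable def restrict (M : ℕ) : CoordRing (M + 2) →ₐ[ℂ] MvPolynomial (Fin 3) ℂ :=
  aeval (restrictVar M)

theorem eval_restrict {M : ℕ} (w : Fin 3 → ℂ) (p : CoordRing (M + 2)) :
    eval w (restrict M p) = eval (fun i => eval w (restrictVar M i)) p := by
  rw [restrict, map_aeval]
  congr 2
  ext
  simp

/-- The equations of such a flat involve only the first three coordinates, so the constants put in
the others do not affect membership. -/
theorem eval_restrict_eq_zero {M n : ℕ} {p : CoordRing (M + 2)} (hp : p ∈ fermatIdeal (M + 2) n)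
    {i j k : Fin 3} {α β : ℂ}
    (hW : coordHyperplane (N := M + 2) (i.castLE (by omega)) (k.castLE (by omega)) α ⊓
      coordHyperplane (j.castLE (by omega)) (k.castLE (by omega)) β ∈ fermatFlats (M + 2) n)
    {w : Fin 3 → ℂ} (hi : w i = α * w k) (hj : w j = β * w k) (hw : w ≠ 0) :
    eval w (restrict M p) = 0 := by
  have hv : ∀ i : Fin 3, eval w (restrictVar M (i.castLE (by omega))) = w i := by
    intro i
    fin_cases i
    · exact eval_X _
    · exact eval_X _
    · exact eval_X _
  rw [eval_restrict]
  refine mem_fermatIdeal_iff.1 hp _ hW _ ⟨?_, ?_⟩ fun h => hw (funext fun i => ?_)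
  · rw [SetLike.mem_coe, mem_coordHyperplane]
    simp only [hv, hi]
  · rw [SetLike.mem_coe, mem_coordHyperplane]
    simp only [hv, hj]
  · rw [← hv i]
    exact congrFun h _

theorem vanishesAtFermatPoints_restrict {M n : ℕ} (hn : 3 ≤ n) {p : CoordRing (M + 2)}
    (hp : p ∈ fermatIdeal (M + 2) n) : VanishesAtFermatPoints n (restrict M p) := by
  have hinj : ∀ {i j : Fin 3}, i ≠ j →
      i.castLE (show 3 ≤ M + 2 + 1 by omega) ≠ j.castLE (show 3 ≤ M + 2 + 1 by omega) :=
    fun h h' => h (Fin.castLE_injective _ h')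
  refine ⟨fun α β t hα hβ ht => ?_, fun i t ht => ?_⟩
  · refine eval_restrict_eq_zero hp (i := 0) (j := 1) (k := 2) (flat_of_roots_of_unity (by omega)
      (hinj (by decide)) (hinj (by decide)) (hinj (by decide)) hα hβ) (by simp [mul_comm])
      (by simp [mul_comm]) fun h => ht ?_
    simpa using congrFun h 2
  · obtain ⟨j, k, hjk, hji, hki⟩ : ∃ j k : Fin 3, j ≠ k ∧ j ≠ i ∧ k ≠ i := by
      revert i
      decide
    refine eval_restrict_eq_zero hp (i := j) (j := k) (k := i) (flat_of_coordinates hn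
      (hinj hjk) (hinj hji) (hinj hki)) (by simp [hji]) (by simp [hki]) fun h => ht ?_
    simpa using congrFun h i

/-- The coefficients of `x^n y^{2n}` and `x^n z^{2n}` agree on the square of the ideal. -/
theorem coeff_restrict_eq_of_mem_sq {M n : ℕ} (hn : 3 ≤ n) {p : CoordRing (M + 2)}
    (hp : p ∈ fermatIdeal (M + 2) n ^ 2) :
    coeff (Finsupp.single 0 n + Finsupp.single 1 (2 * n)) (restrict M p) =
      coeff (Finsupp.single 0 n + Finsupp.single 2 (2 * n)) (restrict M p) := by
  rw [pow_two] at hp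
  refine Submodule.mul_induction_on hp (fun a ha b hb => ?_) fun a b ha hb => ?_
  · rw [map_mul]
    exact (vanishesAtFermatPoints_restrict hn ha).coeff_mul_eq
      (vanishesAtFermatPoints_restrict hn hb)
  · rw [map_add, coeff_add, coeff_add, ha, hb]

/-- In degree `d` only the constant term of `g` can contribute, since `f` already has degree `d`. -/
theorem coeff_mul_of_isHomogeneous {σ R : Type*} [CommSemiring R] {f g : MvPolynomial σ R}
    {d : ℕ} (hf : f.IsHomogeneous d) {m : σ →₀ ℕ} (hm : m.degree = d) :
    coeff m (f * g) = coeff m f * constantCoeff g := by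
  classical
  rw [coeff_mul, Finset.sum_eq_single (m, 0)]
  · rfl
  · rintro ⟨u, v⟩ huv hne
    rw [Finset.HasAntidiagonal.mem_antidiagonal] at huv
    simp only at huv ⊢
    rw [hf.coeff_eq_zero, zero_mul]
    intro hu
    have hv : v = 0 := by
      rw [← Finsupp.degree_eq_zero_iff]
      have := congrArg Finsupp.degree huv
      rw [map_add] at this
      omega
    subst hv
    exact hne (by simpa using huv)
  · simp

noncomputable def fermatPlane (n : ℕ) : MvPolynomial (Fin 3) ℂ :=
  (X 0 ^ n - X 1 ^ n) * (X 0 ^ n - X 2 ^ n) * (X 1 ^ n - X 2 ^ n)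

theorem isHomogeneous_fermatPlane (n : ℕ) : (fermatPlane n).IsHomogeneous (3 * n) := by
  have h : ∀ i j : Fin 3, (X i ^ n - X j ^ n : MvPolynomial (Fin 3) ℂ).IsHomogeneous n :=
    fun i j => (isHomogeneous_X_pow i n).sub (isHomogeneous_X_pow j n)
  rw [show 3 * n = n + n + n by ring]
  exact ((h 0 1).mul (h 0 2)).mul (h 1 2)

theorem fermatPlane_eq (n : ℕ) : fermatPlane n =
    monomial (Finsupp.single 0 (2 * n) + Finsupp.single 1 n) 1
    - monomial (Finsupp.single 0 (2 * n) + Finsupp.single 2 n) 1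
    - monomial (Finsupp.single 0 n + Finsupp.single 1 (2 * n)) 1
    + monomial (Finsupp.single 0 n + Finsupp.single 2 (2 * n)) 1
    + monomial (Finsupp.single 1 (2 * n) + Finsupp.single 2 n) 1
    - monomial (Finsupp.single 1 n + Finsupp.single 2 (2 * n)) 1 := by
  have h : ∀ (i j : Fin 3) (a b : ℕ), (monomial (Finsupp.single i a + Finsupp.single j b) 1 :
      MvPolynomial (Fin 3) ℂ) = X i ^ a * X j ^ b := fun i j a b => by
    simp [X_pow_eq_monomial, monomial_mul]
  simp only [h, fermatPlane]
  ring

theorem single_add_single_ne {i j k l : Fin 3} {a b c d : ℕ} (e : Fin 3)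
    (h : (Finsupp.single i a + Finsupp.single j b : Fin 3 →₀ ℕ) e ≠
      (Finsupp.single k c + Finsupp.single l d : Fin 3 →₀ ℕ) e) :
    (Finsupp.single i a + Finsupp.single j b : Fin 3 →₀ ℕ) ≠
      Finsupp.single k c + Finsupp.single l d :=
  fun h' => h (by rw [h'])

theorem coeff_fermatPlane_one {n : ℕ} (hn : n ≠ 0) :
    coeff (Finsupp.single 0 n + Finsupp.single 1 (2 * n)) (fermatPlane n) = -1 := by
  rw [fermatPlane_eq]
  simp only [coeff_add, coeff_sub, coeff_monomial]
  rw [if_neg (single_add_single_ne 0 (by simp; omega)),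
    if_neg (single_add_single_ne 0 (by simp; omega)), if_true,
    if_neg (single_add_single_ne 1 (by simp; omega)),
    if_neg (single_add_single_ne 0 (by simp; omega)),
    if_neg (single_add_single_ne 0 (by simp; omega))]
  norm_num

theorem coeff_fermatPlane_two {n : ℕ} (hn : n ≠ 0) :
    coeff (Finsupp.single 0 n + Finsupp.single 2 (2 * n)) (fermatPlane n) = 1 := by
  rw [fermatPlane_eq]
  simp only [coeff_add, coeff_sub, coeff_monomial]
  rw [if_neg (single_add_single_ne 0 (by simp; omega)),
    if_neg (single_add_single_ne 0 (by simp; omega)),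
    if_neg (single_add_single_ne 1 (by simp; omega)), if_true,
    if_neg (single_add_single_ne 0 (by simp; omega)),
    if_neg (single_add_single_ne 0 (by simp; omega))]
  norm_num

/-- `G` collects the factors involving some `x_i` with `i ≥ 3`. Its constant term is nonzero because
the substituted constants are nonzero and have distinct `n`-th powers. -/
theorem restrict_fermatPoly (M : ℕ) {n : ℕ} (hn : n ≠ 0) :
    ∃ G : MvPolynomial (Fin 3) ℂ, constantCoeff G ≠ 0 ∧
      restrict M (fermatPoly (M + 2) n) = fermatPlane n * G := by
  refine ⟨(∏ k : Fin M, (X 0 ^ n - C ((k : ℂ) + 1) ^ n)) *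
    (∏ k : Fin M, (X 1 ^ n - C ((k : ℂ) + 1) ^ n)) *
    (∏ k : Fin M, (X 2 ^ n - C ((k : ℂ) + 1) ^ n)) *
    ∏ k : Fin M, ∏ l ∈ Finset.Ioi k, (C ((k : ℂ) + 1) ^ n - C ((l : ℂ) + 1) ^ n), ?_, ?_⟩
  · have hne : ∏ k : Fin M, -((k : ℂ) + 1) ^ n ≠ 0 := Finset.prod_ne_zero_iff.2 fun k _ =>
      neg_ne_zero.2 (pow_ne_zero _ (Nat.cast_add_one_ne_zero _))
    simp only [map_mul, map_prod, map_sub, map_pow, constantCoeff_X, constantCoeff_C, ne_eq, hn,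
      not_false_eq_true, zero_pow, zero_sub]
    refine mul_ne_zero (mul_ne_zero (mul_ne_zero hne hne) hne) (Finset.prod_ne_zero_iff.2
      fun k _ => Finset.prod_ne_zero_iff.2 fun l hl => sub_ne_zero.2 fun h => ?_)
    have h' : ((k : ℕ) + 1) ^ n = ((l : ℕ) + 1) ^ n := by exact_mod_cast h
    have := Nat.pow_left_injective hn h'
    have := Finset.mem_Ioi.1 hl
    omega
  · have hX : ∀ i, restrict M (X i) = restrictVar M i := fun i => aeval_X _ i
    simp only [fermatPoly, map_prod, map_sub, map_pow, hX]
    -- Splitting off the rows `i = 0, 1, 2` of the double product separates the plane factors from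
    -- `G`.
    rw [Fin.prod_univ_succ, Fin.prod_univ_succ, Fin.prod_univ_succ]
    simp only [Fin.prod_Ioi_succ, Fin.prod_Ioi_zero, Fin.prod_univ_succ, restrictVar,
      Fin.cons_succ, Fin.cons_zero, fermatPlane]
    ring

theorem fermatPoly_notMem_sq {N n : ℕ} (hN : 2 ≤ N) (hn : 3 ≤ n) :
    fermatPoly N n ∉ fermatIdeal N n ^ 2 := by
  obtain ⟨M, rfl⟩ := Nat.exists_eq_add_of_le' hN
  intro h
  have h := coeff_restrict_eq_of_mem_sq hn h
  obtain ⟨G, hG, hF⟩ := restrict_fermatPoly M (n := n) (by omega)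
  have hdeg : ∀ i : Fin 3,
      (Finsupp.single 0 n + Finsupp.single i (2 * n) : Fin 3 →₀ ℕ).degree = 3 * n := fun i => by
    simp only [map_add, Finsupp.degree_single]
    ring
  rw [hF, coeff_mul_of_isHomogeneous (isHomogeneous_fermatPlane n) (hdeg 1),
    coeff_mul_of_isHomogeneous (isHomogeneous_fermatPlane n) (hdeg 2),
    coeff_fermatPlane_one (by omega), coeff_fermatPlane_two (by omega)] at h
  have := mul_right_cancel₀ hG h
  norm_num at this

end FermatFlats

theorem mainTheorem1 (N n : ℕ) (hN : 2 ≤ N) (hn : 3 ≤ n) :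
    ¬ FermatFlats.symbolicPower (FermatFlats.fermatIdeal N n) 3 ≤
        FermatFlats.fermatIdeal N n ^ 2 ∧
      (∀ P ∈ associatedPrimes (FermatFlats.CoordRing N)
          (FermatFlats.CoordRing N ⧸ FermatFlats.fermatIdeal N n),
        FermatFlats.fermatPoly N n ∈ P ^ 3) ∧
      FermatFlats.fermatPoly N n ∈
        FermatFlats.symbolicPower (FermatFlats.fermatIdeal N n) 3 ∧
      FermatFlats.fermatPoly N n ∉ FermatFlats.fermatIdeal N n ^ 2 := by
  have hass : ∀ P ∈ associatedPrimes (FermatFlats.CoordRing N)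
      (FermatFlats.CoordRing N ⧸ FermatFlats.fermatIdeal N n),
      FermatFlats.fermatPoly N n ∈ P ^ 3 := fun P hP =>
    FermatFlats.fermatPoly_mem_pow_three_of_fermatIdeal_le (by omega) hP.isPrime
      (FermatFlats.le_of_mem_associatedPrimes hP)
  have hsymb := FermatFlats.mem_symbolicPower
    (fun _ => FermatFlats.mem_fermatIdeal_of_sq_mem) hass
  have hsq := FermatFlats.fermatPoly_notMem_sq hN hn
  exact ⟨fun h => hsq (h hsymb), hass, hsymb, hsq⟩
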